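/- **Setting.** For a lattice $\Lambda\subset\mathbb R^2$ let $\Gamma_\Lambda=\{x\mapsto 2\lambda\pm x:\lambda\in\Lambda\}$ and let $\pi_\Lambda:\mathbb R^2\to\mathbb R^2/\Gamma_\Lambda$ be the quotient map onto the quotient sphere. Put $\Lambda_2=\mathbb Z^2$, $\Gamma_2=\Gamma_{\Lambda_2}$, $\pi_2=\pi_{\Lambda_2}$, $S^2_2=\mathbb R^2/\Gamma_2$, $P_2=\pi_2(\Lambda_2)$. A *presentation diagram* $\mathbf D$ consists of 1. an ordered basis $(\lambda_1,\lambda_2)$, with $\det[\lambda_1,\lambda_2]>0$, of a proper sublattice $\Lambda_1$ of $\mathbb Z^2$; let $F_1$ be the closed parallelogram with sides joining $0$ to $2\lambda_1$ and to $\lambda_2$, and put $\pi_1=\pi_{\Lambda_1}$, $S^2_1=\mathbb R^2/\Gamma_{\Lambda_1}$, $P_1=\pi_1(\Lambda_1)$; 2. an element $b\in\{0,\lambda_1,\lambda_2,\lambda_1+\lambda_2\}$; 3. for each of the four points $p_j\in P_1$ a (possibly degenerate) geodesic arc $\beta_j$ in $S^2_1$ from $p_j$ to a point of $\pi_1(\Lambda_2)$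 which lifts to a line segment in $F_1$, these four arcs being pairwise disjoint. A matrix $A\in\mathrm{Mat}^+(2,\mathbb Z)$ (integer entries, $\det A>0$) acts on diagrams by transforming $\lambda_1$, $\lambda_2$, $b$ and the arcs by $A$. Write $-\mathbf D=(-I)\cdot\mathbf D$, where $I$ is the identity matrix, and let $[\mathbf D]=\{\mathbf D,-\mathbf D\}$ be the projective class of $\mathbf D$; then $A$ acts on projective classes. A diagram $\mathbf D$ determines maps $F=\overline{\mathrm{id}}\circ h\circ\phi:(S^2_2,P_2)\to(S^2_2,P_2)$, where $\phi:S^2_2\to S^2_1$ is induced by $x=(x_1,x_2)\mapsto x_1\lambda_1+x_2\lambda_2+b$, where $h:S^2_1\to S^2_1$ is a push-point homeomorphism pushing each $p_j$ along $\beta_j$ (that is, $h$ is the end of an ambient isotopy of $S^2_1$ starting at the identity and moving $p_j$ along $\beta_j$ for all $j$ simultaneously), and where $\overline{\mathrm{id}}:S^2_1\to S^2_2$ is induced by the identity of $\mathbb R^2$. The maps *corresponding to* $[\mathbf D]$ are those determined in this way by $\mathbf D$ or by $-\mathbf D$. Isotopic rel $P_2$ means equal after precomposition with the end of an ambient isotopy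 of $S^2_2$ which starts at the identity and fixes $P_2$ pointwise at all times. **Theorem 1.2.** Suppose that $A\in\mathrm{Mat}^+(2,\mathbb Z)$ sends $[\mathbf D]$ to $[\mathbf D']$. Let $A_2:(S^2_2,P_2)\to(S^2_2,P_2)$ be the map induced by $x\mapsto Ax$, and let $F$ be a map corresponding to $[\mathbf D]$. Then $A_2\circ F$ is itself one of the maps corresponding to $[\mathbf D']$, and every map $F'$ corresponding to $[\mathbf D']$ is isotopic to $A_2\circ F$ rel $P_2$. -/

import Mathlib

namespace NetMap

/-- The Euclidean plane `ℝ²` (only its affine structure and topology are used). -/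
abbrev Plane : Type := Fin 2 → ℝ

/-- An integer vector, regarded as a point of the plane. -/
def toPlane (v : Fin 2 → ℤ) : Plane := fun i => (v i : ℝ)

/-- The real linear map `x ↦ A x` of the plane given by an integer matrix `A`. -/
noncomputable def linR (A : Matrix (Fin 2) (Fin 2) ℤ) : Plane →ₗ[ℝ] Plane :=
  Matrix.toLin' (A.map (Int.cast : ℤ → ℝ))

/-- The standard integer lattice `Λ₂ = ℤ²` in the plane. -/
def stdLattice : AddSubgroup Plane := ((Int.castAddHom ℝ).compLeft (Fin 2)).range

/-- The subgroup of the plane generated by two integer vectors. -/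
def spanLattice (u v : Fin 2 → ℤ) : AddSubgroup Plane :=
  AddSubgroup.closure {toPlane u, toPlane v}

/-- The closed parallelogram spanned by `2u` and `v`, with one corner at the origin. -/
def parallelogram (u v : Fin 2 → ℤ) : Set Plane :=
  {x | ∃ s ∈ Set.Icc (0 : ℝ) 1, ∃ t ∈ Set.Icc (0 : ℝ) 1,
    x = s • ((2 : ℝ) • toPlane u) + t • toPlane v}

/-- The orbit relation of the group `Γ_L = {x ↦ 2v ± x : v ∈ L}`. -/
def orbitSetoid (L : AddSubgroup Plane) : Setoid Plane where
  r x y := ∃ v ∈ L, y = (2 : ℝ) • v + x ∨ y = (2 : ℝ) • v - x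
  iseqv :=
    { refl := fun x => ⟨0, L.zero_mem, Or.inl (by simp)⟩
      symm := by
        rintro x y ⟨v, hv, rfl | rfl⟩
        · exact ⟨-v, L.neg_mem hv, Or.inl (by simp)⟩
        · exact ⟨v, hv, Or.inr (by simp)⟩
      trans := by
        rintro x y z ⟨v, hv, rfl | rfl⟩ ⟨w, hw, rfl | rfl⟩
        · exact ⟨w + v, L.add_mem hw hv, Or.inl (by module)⟩
        · exact ⟨w - v, L.sub_mem hw hv, Or.inr (by module)⟩
        · exact ⟨w + v, L.add_mem hw hv, Or.inr (by module)⟩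
        · exact ⟨w - v, L.sub_mem hw hv, Or.inl (by module)⟩ }

/-- The quotient `ℝ² / Γ_L`, a topological sphere when `L` is a lattice. -/
def Sphere (L : AddSubgroup Plane) : Type := Quotient (orbitSetoid L)

/-- `Sphere L` carries the quotient topology. -/
instance (L : AddSubgroup Plane) : TopologicalSpace (Sphere L) :=
  inferInstanceAs (TopologicalSpace (Quotient (orbitSetoid L)))

/-- The quotient map `π_L : ℝ² → ℝ² / Γ_L`. -/
def proj (L : AddSubgroup Plane) (x : Plane) : Sphere L := Quotient.mk (orbitSetoid L) x

/-- The set of corner points `π_L(L)`. -/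
def corners (L : AddSubgroup Plane) : Set (Sphere L) := proj L '' (L : Set Plane)

/-- The map `ℝ² / Γ_L → ℝ² / Γ_L'` induced by an affine map `Φ` of the plane
with `Φ(L) ⊆ L'`; it satisfies `induced Φ ∘ π_L = π_L' ∘ Φ`. -/
def induced {L L' : AddSubgroup Plane} (Φ : Plane →ᵃ[ℝ] Plane)
    (h : ∀ v ∈ L, Φ v ∈ L') : Sphere L → Sphere L' :=
  Quotient.map (sa := orbitSetoid L) (sb := orbitSetoid L') Φ (by
    have hΦ : ∀ x, Φ x = Φ.linear x + Φ 0 := fun x => congrFun (AffineMap.decomp Φ) x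
    have hlin : ∀ v ∈ L, Φ.linear v ∈ L' := fun v hv => by
      have h1 := L'.sub_mem (h v hv) (h 0 L.zero_mem)
      rw [hΦ v] at h1
      simpa using h1
    rintro x y ⟨v, hv, rfl | rfl⟩
    · refine ⟨Φ.linear v, hlin v hv, Or.inl ?_⟩
      rw [hΦ, hΦ x, map_add, map_smul]
      abel
    · refine ⟨Φ.linear v + Φ 0, L'.add_mem (hlin v hv) (h 0 L.zero_mem), Or.inr ?_⟩
      rw [hΦ, hΦ x, map_sub, map_smul]
      module)

/-- The integer matrix with columns `u`, `v`. -/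
def colMatrix (u v : Fin 2 → ℤ) : Matrix (Fin 2) (Fin 2) ℤ :=
  Matrix.of fun i j => ![u, v] j i

/-- A presentation diagram: an ordered basis of a proper sublattice `Λ₁` of `ℤ²`, a circled point,
and green geodesic arcs in the quotient sphere `ℝ² / Γ₁` issuing from its four corners. -/
structure Diagram where
  /-- the first basis vector of `Λ₁` -/
  lam₁ : Fin 2 → ℤ
  /-- the second basis vector of `Λ₁` -/
  lam₂ : Fin 2 → ℤ
  /-- The basis is positively oriented and the sublattice `Λ₁` is proper: the determinant, which is
  the index of `Λ₁` in `ℤ²` if it is positive, exceeds `1`. -/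
  one_lt_det : 1 < (colMatrix lam₁ lam₂).det
  /-- the circled point -/
  b : Fin 2 → ℤ
  b_mem : b ∈ ({0, lam₁, lam₂, lam₁ + lam₂} : Set (Fin 2 → ℤ))
  /-- the (unlabelled) set of green arcs, each parametrized at constant speed from its initial to
  its terminal point -/
  green : Set (unitInterval → Sphere (spanLattice lam₁ lam₂))
  /-- Every green arc is the image of a (possibly degenerate) line segment `[x, y]` in the
  parallelogram `F₁`, leading from a point of `Λ₁` to a point of `Λ₂ = ℤ²`. -/
  green_geodesic : ∀ β ∈ green,
    ∃ x ∈ parallelogram lam₁ lam₂, ∃ y ∈ parallelogram lam₁ lam₂,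
      x ∈ spanLattice lam₁ lam₂ ∧ y ∈ stdLattice ∧
        ∀ t : unitInterval,
          β t = proj (spanLattice lam₁ lam₂) (AffineMap.lineMap x y (t : ℝ))
  /-- There is exactly one green arc for each corner. -/
  green_existsUnique : ∀ p ∈ corners (spanLattice lam₁ lam₂), ∃! β, β ∈ green ∧ β 0 = p
  /-- The green arcs are pairwise disjoint. -/
  green_disjoint : green.Pairwise fun β γ => Disjoint (Set.range β) (Set.range γ)

theorem linR_toPlane (A : Matrix (Fin 2) (Fin 2) ℤ) (v : Fin 2 → ℤ) :
    linR A (toPlane v) = toPlane (A.mulVec v) := by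
  ext i
  simp [linR, toPlane, Matrix.mulVec, dotProduct]

theorem toPlane_mem_stdLattice (v : Fin 2 → ℤ) : toPlane v ∈ stdLattice := ⟨v, rfl⟩

theorem linR_mem_stdLattice (A : Matrix (Fin 2) (Fin 2) ℤ) (x : Plane) (hx : x ∈ stdLattice) :
    linR A x ∈ stdLattice := by
  obtain ⟨v, rfl⟩ := hx
  exact ⟨A.mulVec v, (linR_toPlane A v).symm⟩

theorem mem_spanLattice {u v : Fin 2 → ℤ} {x : Plane} :
    x ∈ spanLattice u v ↔ ∃ m n : ℤ, m • toPlane u + n • toPlane v = x :=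
  AddSubgroup.mem_closure_pair

theorem spanLattice_le (u v : Fin 2 → ℤ) : ∀ x ∈ spanLattice u v, x ∈ stdLattice := by
  intro x hx
  obtain ⟨m, n, rfl⟩ := mem_spanLattice.1 hx
  exact stdLattice.add_mem (stdLattice.zsmul_mem (toPlane_mem_stdLattice u) m)
    (stdLattice.zsmul_mem (toPlane_mem_stdLattice v) n)

theorem linR_mem_spanLattice (A : Matrix (Fin 2) (Fin 2) ℤ) (u v : Fin 2 → ℤ) :
    ∀ x ∈ spanLattice u v, linR A x ∈ spanLattice (A.mulVec u) (A.mulVec v) := by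
  intro x hx
  obtain ⟨m, n, rfl⟩ := mem_spanLattice.1 hx
  refine mem_spanLattice.2 ⟨m, n, ?_⟩
  rw [map_add, map_zsmul, map_zsmul, linR_toPlane, linR_toPlane]

theorem linR_mem_parallelogram (A : Matrix (Fin 2) (Fin 2) ℤ) (u v : Fin 2 → ℤ) :
    ∀ x ∈ parallelogram u v, linR A x ∈ parallelogram (A.mulVec u) (A.mulVec v) := by
  rintro x ⟨s, hs, t, ht, rfl⟩
  refine ⟨s, hs, t, ht, ?_⟩
  rw [map_add, map_smul, map_smul, map_smul, linR_toPlane, linR_toPlane]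

theorem linR_injective (A : Matrix (Fin 2) (Fin 2) ℤ) (hA : 0 < A.det) :
    Function.Injective (linR A) := by
  have hdet : (A.map (Int.cast : ℤ → ℝ)).det ≠ 0 := by
    have h1 : (A.map (Int.cast : ℤ → ℝ)).det = ((A.det : ℤ) : ℝ) :=
      ((Int.castRingHom ℝ).map_det A).symm
    rw [h1]
    exact_mod_cast hA.ne'
  intro x y hxy
  have h2 : (A.map (Int.cast : ℤ → ℝ)).mulVec x = (A.map (Int.cast : ℤ → ℝ)).mulVec y := by
    simpa [linR] using hxy
  exact Matrix.mulVec_injective_of_isUnit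
    ((Matrix.isUnit_iff_isUnit_det _).2 (isUnit_iff_ne_zero.2 hdet)) h2

/-- The map `A₁` from `ℝ² / Γ_L` to `ℝ² / Γ_{AL}` induced by `A`, where `L` is generated by `u`
and `v`. -/
noncomputable def linSpan (A : Matrix (Fin 2) (Fin 2) ℤ) (u v : Fin 2 → ℤ) :
    Sphere (spanLattice u v) → Sphere (spanLattice (A.mulVec u) (A.mulVec v)) :=
  induced (linR A).toAffineMap (linR_mem_spanLattice A u v)

theorem linSpan_injective (A : Matrix (Fin 2) (Fin 2) ℤ) (hA : 0 < A.det) (u v : Fin 2 → ℤ) :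
    Function.Injective (linSpan A u v) := by
  intro p q
  refine Quotient.inductionOn₂ p q fun x y hxy => ?_
  obtain ⟨w, hw, h⟩ := Quotient.exact hxy
  obtain ⟨m, n, rfl⟩ := mem_spanLattice.1 hw
  refine Quotient.sound ⟨m • toPlane u + n • toPlane v, mem_spanLattice.2 ⟨m, n, rfl⟩, ?_⟩
  have key : m • toPlane (A.mulVec u) + n • toPlane (A.mulVec v)
      = linR A (m • toPlane u + n • toPlane v) := by
    rw [map_add, map_zsmul, map_zsmul, linR_toPlane, linR_toPlane]
  rw [key] at h
  rcases h with h | h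
  · refine Or.inl (linR_injective A hA ?_)
    rw [map_add, map_smul]
    exact h
  · refine Or.inr (linR_injective A hA ?_)
    rw [map_sub, map_smul]
    exact h

namespace Diagram

/-- The diagram `A · D` obtained by applying to `D` the linear map given by an integer matrix `A`
of positive determinant: the basis, the circled point and the green arcs are transformed
by `A`. -/
noncomputable def transform (A : Matrix (Fin 2) (Fin 2) ℤ) (hA : 0 < A.det) (D : Diagram) :
    Diagram where
  lam₁ := A.mulVec D.lam₁
  lam₂ := A.mulVec D.lam₂
  one_lt_det := by
    have h1 : colMatrix (A.mulVec D.lam₁) (A.mulVec D.lam₂) = A * colMatrix D.lam₁ D.lam₂ := by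
      ext i j
      fin_cases i <;> fin_cases j <;> simp [colMatrix, Matrix.mul_apply]
    rw [h1, Matrix.det_mul]
    have h2 := D.one_lt_det
    nlinarith
  b := A.mulVec D.b
  b_mem := by
    rcases D.b_mem with h | h | h | h <;> rw [h] <;> simp [Matrix.mulVec_add]
  green := (fun β t => linSpan A D.lam₁ D.lam₂ (β t)) '' D.green
  green_geodesic := by
    rintro _ ⟨β, hβ, rfl⟩
    obtain ⟨x, hx, y, hy, hxL, hyL, h⟩ := D.green_geodesic β hβ
    refine ⟨linR A x, linR_mem_parallelogram A _ _ x hx, linR A y,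
      linR_mem_parallelogram A _ _ y hy, linR_mem_spanLattice A _ _ x hxL,
      linR_mem_stdLattice A y hyL, fun t => ?_⟩
    have h3 : AffineMap.lineMap (linR A x) (linR A y) (t : ℝ)
        = linR A (AffineMap.lineMap x y (t : ℝ)) := by
      simp [AffineMap.lineMap_apply]
    rw [h3]
    simp only [h t]
    rfl
  green_existsUnique := by
    rintro _ ⟨z, hz, rfl⟩
    obtain ⟨m, n, rfl⟩ := mem_spanLattice.1 hz
    have hp : proj (spanLattice (A.mulVec D.lam₁) (A.mulVec D.lam₂))
        (m • toPlane (A.mulVec D.lam₁) + n • toPlane (A.mulVec D.lam₂))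
        = linSpan A D.lam₁ D.lam₂ (proj _ (m • toPlane D.lam₁ + n • toPlane D.lam₂)) := by
      change _ = proj _ (linR A (m • toPlane D.lam₁ + n • toPlane D.lam₂))
      rw [map_add, map_zsmul, map_zsmul, linR_toPlane, linR_toPlane]
    rw [hp]
    obtain ⟨β, ⟨hβ, hβ0⟩, huniq⟩ := D.green_existsUnique _
      ⟨m • toPlane D.lam₁ + n • toPlane D.lam₂, mem_spanLattice.2 ⟨m, n, rfl⟩, rfl⟩
    refine ⟨_, ⟨⟨β, hβ, rfl⟩, congrArg _ hβ0⟩, ?_⟩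
    rintro _ ⟨⟨γ, hγ, rfl⟩, hγ0⟩
    rw [huniq γ ⟨hγ, linSpan_injective A hA _ _ hγ0⟩]
  green_disjoint := by
    rintro _ ⟨β, hβ, rfl⟩ _ ⟨γ, hγ, rfl⟩ hne
    have hne' : β ≠ γ := fun h => hne (by rw [h])
    have hd := Set.disjoint_left.1 (D.green_disjoint hβ hγ hne')
    refine Set.disjoint_left.2 ?_
    rintro _ ⟨s, rfl⟩ ⟨t, ht⟩
    exact hd ⟨s, rfl⟩ ⟨t, linSpan_injective A hA _ _ ht⟩

/-- The diagram `-D`. -/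
noncomputable def neg (D : Diagram) : Diagram :=
  D.transform (-1) (by simp [Matrix.det_fin_two])

/-- The projective class `[D] = {D, -D}`. -/
def projClass (D : Diagram) : Set Diagram := {D, D.neg}

/-- The affine isomorphism `Φ(x) = x₁ λ₁ + x₂ λ₂ + b`, which takes `ℤ²` onto `Λ₁` and the origin
to `b`. -/
noncomputable def Phi (D : Diagram) : Plane →ᵃ[ℝ] Plane :=
  (linR (colMatrix D.lam₁ D.lam₂)).toAffineMap + AffineMap.const ℝ Plane (toPlane D.b)

theorem Phi_mem (D : Diagram) : ∀ v ∈ stdLattice, D.Phi v ∈ spanLattice D.lam₁ D.lam₂ := by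
  rintro _ ⟨v, rfl⟩
  have h1 : D.Phi (toPlane v)
      = (v 0 • toPlane D.lam₁ + v 1 • toPlane D.lam₂) + toPlane D.b := by
    change linR (colMatrix D.lam₁ D.lam₂) (toPlane v) + toPlane D.b = _
    rw [linR_toPlane]
    ext i
    fin_cases i <;> simp [toPlane, colMatrix] <;> ring
  have hb : toPlane D.b ∈ spanLattice D.lam₁ D.lam₂ := by
    rw [mem_spanLattice]
    rcases D.b_mem with h | h | h | h <;> rw [h]
    · exact ⟨0, 0, by ext i; simp [toPlane]⟩
    · exact ⟨1, 0, by ext i; simp [toPlane]⟩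
    · exact ⟨0, 1, by ext i; simp [toPlane]⟩
    · exact ⟨1, 1, by ext i; simp [toPlane]⟩
  change D.Phi (toPlane v) ∈ _
  rw [h1]
  exact AddSubgroup.add_mem _ (mem_spanLattice.2 ⟨v 0, v 1, rfl⟩) hb

/-- The map `φ : S₂ → S₁` induced by `Φ`. -/
noncomputable def phi (D : Diagram) : Sphere stdLattice → Sphere (spanLattice D.lam₁ D.lam₂) :=
  induced D.Phi D.Phi_mem

/-- The branched covering `S₁ → S₂` induced by the identity map of the plane. -/
noncomputable def idBar (D : Diagram) : Sphere (spanLattice D.lam₁ D.lam₂) → Sphere stdLattice :=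
  induced (AffineMap.id ℝ Plane) (spanLattice_le D.lam₁ D.lam₂)

end Diagram

/-- An ambient isotopy of a space `X`: a family of homeomorphisms of `X`, indexed by the unit
interval and jointly continuous together with its inverses (so a level-preserving homeomorphism
of `I × X`), that starts at the identity. -/
structure AmbientIsotopy (X : Type*) [TopologicalSpace X] where
  /-- the homeomorphism at time `t` -/
  hom : unitInterval → X ≃ₜ X
  continuous_hom : Continuous fun q : unitInterval × X => hom q.1 q.2
  continuous_symm : Continuous fun q : unitInterval × X => (hom q.1).symm q.2
  hom_zero : hom 0 = Homeomorph.refl X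

/-- Two maps `F`, `G` from `X` to `Y` are isotopic relative to `P ⊆ X`: there is an ambient
isotopy `ψ` of `X`, stationary on `P`, with `G = F ∘ ψ₁`; so `F` is deformed to `G` through the
maps `F ∘ ψ_t`, which are branched coverings if `F` is one, and agree with `F` on `P`. -/
def IsotopicRel {X Y : Type*} [TopologicalSpace X] (P : Set X) (F G : X → Y) : Prop :=
  ∃ ψ : AmbientIsotopy X, (∀ t, ∀ p ∈ P, ψ.hom t p = p) ∧ G = fun x => F (ψ.hom 1 x)

namespace Diagram

/-- `h` is a push-point homeomorphism for the diagram: the end of an ambient isotopy of `S₁`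
during which each of the four corners travels along its green arc. -/
def IsPush (D : Diagram)
    (h : Sphere (spanLattice D.lam₁ D.lam₂) ≃ₜ Sphere (spanLattice D.lam₁ D.lam₂)) : Prop :=
  ∃ H : AmbientIsotopy (Sphere (spanLattice D.lam₁ D.lam₂)),
    H.hom 1 = h ∧ ∀ β ∈ D.green, ∀ t, H.hom t (β 0) = β t

/-- `F` is a Thurston map given by the diagram: the composition of `φ : S₂ → S₁`, a
push-point homeomorphism `h` of `S₁` and the map `S₁ → S₂` induced by the identity. The
push-point homeomorphism, and so `F`, is determined only up to isotopy. -/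
def Gives (D : Diagram) (F : Sphere stdLattice → Sphere stdLattice) : Prop :=
  ∃ h, D.IsPush h ∧ F = fun x => D.idBar (h (D.phi x))

/-- `F` is a Thurston map given by the projective class of the diagram, that is, by one
of its two representatives. -/
def ClassGives (D : Diagram) (F : Sphere stdLattice → Sphere stdLattice) : Prop :=
  ∃ E ∈ D.projClass, E.Gives F

end Diagram

/-- The map `A₂` of `S₂ = ℝ² / Γ₂` induced by an integer matrix `A`. -/
noncomputable def linStd (A : Matrix (Fin 2) (Fin 2) ℤ) : Sphere stdLattice → Sphere stdLattice :=
  induced (linR A).toAffineMap (linR_mem_stdLattice A)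

end NetMap

namespace NetMap

/-! The matrix `A` induces a homeomorphism `A₁` from the sphere `S₁` of `D` to that of `A · D`, and
it intertwines the two constructions: `A₁ ∘ φ` is the new `φ` (`linSpan_phi`), and `A₂ ∘ idBar` is
the new `idBar` after `A₁` (`linStd_idBar`). Conjugating a push `h` by `A₁` gives a push for `A ·
D`, so `A₂ ∘ F` is a map given by `A · D` (`Gives.transform`). For uniqueness, `-I` induces the
identity on `S₂`, so maps given by `D'` are also given by `-D'`, and all maps of the class come from
a single diagram (`ClassGives.neg_gives`). There only the push can vary. Two isotopies `H`, `K`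
along the same arcs differ by `H_t⁻¹ ∘ K_t`, which fixes the corners; carried to `S₂` by `φ`, it is
the required isotopy (`Gives.isotopicRel`). -/

/-! ### Homeomorphisms of quotient spheres induced by affine maps -/

theorem continuous_proj (L : AddSubgroup Plane) : Continuous (proj L) :=
  continuous_quotient_mk'

theorem continuous_induced {L L' : AddSubgroup Plane} (Φ : Plane →ᵃ[ℝ] Plane)
    (h : ∀ v ∈ L, Φ v ∈ L') : Continuous (induced Φ h) :=
  continuous_quot_lift _ ((continuous_proj L').comp Φ.continuous_of_finiteDimensional)

/-- The homeomorphism `ℝ² / Γ_L ≃ₜ ℝ² / Γ_L'` induced by an affine bijection of the plane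
which takes `L` onto `L'`. -/
noncomputable def inducedHomeo {L L' : AddSubgroup Plane} (Φ : Plane →ᵃ[ℝ] Plane)
    (hΦ : Function.Injective Φ) (h : ∀ v ∈ L, Φ v ∈ L') (h' : ∀ w ∈ L', ∃ v ∈ L, Φ v = w) :
    Sphere L ≃ₜ Sphere L' :=
  have hbij : Function.Bijective Φ := by
    rw [← AffineMap.linear_bijective_iff]
    have hinj := (AffineMap.linear_injective_iff Φ).2 hΦ
    exact ⟨hinj, LinearMap.injective_iff_surjective.1 hinj⟩
  let e : Plane ≃ᵃ[ℝ] Plane := AffineEquiv.ofBijective hbij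
  have he : ∀ w ∈ L', e.symm.toAffineMap w ∈ L := fun w hw => by
    obtain ⟨v, hv, rfl⟩ := h' w hw
    exact (e.symm_apply_apply v).symm ▸ hv
  { toFun := induced Φ h
    invFun := induced e.symm.toAffineMap he
    left_inv := fun p => Quotient.inductionOn p fun x =>
      congrArg (proj L) (e.symm_apply_apply x)
    right_inv := fun p => Quotient.inductionOn p fun x =>
      congrArg (proj L') (e.apply_symm_apply x)
    continuous_toFun := continuous_induced _ _
    continuous_invFun := continuous_induced _ _ }

/-- The homeomorphism `linSpan A u v` for a matrix `A` of positive determinant. -/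
noncomputable def linSpanHomeo (A : Matrix (Fin 2) (Fin 2) ℤ) (hA : 0 < A.det)
    (u v : Fin 2 → ℤ) :
    Sphere (spanLattice u v) ≃ₜ Sphere (spanLattice (A.mulVec u) (A.mulVec v)) :=
  inducedHomeo (linR A).toAffineMap (linR_injective A hA) (linR_mem_spanLattice A u v) (by
    intro w hw
    obtain ⟨m, n, rfl⟩ := mem_spanLattice.1 hw
    refine ⟨m • toPlane u + n • toPlane v, mem_spanLattice.2 ⟨m, n, rfl⟩, ?_⟩
    change linR A _ = _
    rw [map_add, map_zsmul, map_zsmul, linR_toPlane, linR_toPlane])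

theorem linSpanHomeo_apply (A : Matrix (Fin 2) (Fin 2) ℤ) (hA : 0 < A.det) (u v : Fin 2 → ℤ)
    (p : Sphere (spanLattice u v)) : linSpanHomeo A hA u v p = linSpan A u v p := rfl

/-! ### Operations on ambient isotopies -/

namespace AmbientIsotopy

variable {X Y : Type*} [TopologicalSpace X] [TopologicalSpace Y]

/-- The ambient isotopy `t ↦ e ∘ H_t ∘ e⁻¹` obtained by transport along a homeomorphism `e`. -/
def conj (H : AmbientIsotopy X) (e : X ≃ₜ Y) : AmbientIsotopy Y where
  hom t := (e.symm.trans (H.hom t)).trans e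
  continuous_hom := e.continuous.comp <| H.continuous_hom.comp <|
    continuous_fst.prodMk (e.symm.continuous.comp continuous_snd)
  continuous_symm := e.continuous.comp <| H.continuous_symm.comp <|
    continuous_fst.prodMk (e.symm.continuous.comp continuous_snd)
  hom_zero := by
    rw [H.hom_zero]
    ext y
    exact e.apply_symm_apply y

theorem conj_hom_apply (H : AmbientIsotopy X) (e : X ≃ₜ Y) (t : unitInterval) (y : Y) :
    (H.conj e).hom t y = e (H.hom t (e.symm y)) := rfl

/-- The ambient isotopy `t ↦ H_t⁻¹ ∘ K_t`. -/
def symmComp (H K : AmbientIsotopy X) : AmbientIsotopy X where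
  hom t := (K.hom t).trans (H.hom t).symm
  continuous_hom := H.continuous_symm.comp <| continuous_fst.prodMk K.continuous_hom
  continuous_symm := K.continuous_symm.comp <| continuous_fst.prodMk H.continuous_hom
  hom_zero := by
    rw [H.hom_zero, K.hom_zero]
    rfl

theorem symmComp_hom_apply (H K : AmbientIsotopy X) (t : unitInterval) (x : X) :
    (H.symmComp K).hom t x = (H.hom t).symm (K.hom t x) := rfl

end AmbientIsotopy

/-! ### Behaviour of diagrams and their maps under matrices -/

namespace Diagram

theorem Phi_apply (D : Diagram) (x : Plane) :
    D.Phi x = linR (colMatrix D.lam₁ D.lam₂) x + toPlane D.b := rfl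

theorem Phi_injective (D : Diagram) : Function.Injective D.Phi := fun _ _ hxy =>
  linR_injective _ (one_pos.trans D.one_lt_det) (add_right_cancel hxy)

theorem exists_Phi_eq (D : Diagram) :
    ∀ w ∈ spanLattice D.lam₁ D.lam₂, ∃ v ∈ stdLattice, D.Phi v = w := by
  intro w hw
  have hb : toPlane D.b ∈ spanLattice D.lam₁ D.lam₂ := by
    simpa [Phi_apply] using D.Phi_mem 0 stdLattice.zero_mem
  obtain ⟨m, n, h⟩ := mem_spanLattice.1 (AddSubgroup.sub_mem _ hw hb)
  -- The witness consists of the coordinates of `w - b` in the basis `λ₁, λ₂`; here `b = Φ(0)` lies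
  -- in `Λ₁`.
  refine ⟨toPlane ![m, n], toPlane_mem_stdLattice _, ?_⟩
  rw [Phi_apply, ← eq_sub_iff_add_eq, ← h, linR_toPlane]
  ext i
  fin_cases i <;> simp [toPlane, colMatrix, Matrix.mulVec, dotProduct] <;> ring

/-- The map `φ` of a diagram as a homeomorphism. -/
noncomputable def phiHomeo (D : Diagram) :
    Sphere stdLattice ≃ₜ Sphere (spanLattice D.lam₁ D.lam₂) :=
  inducedHomeo D.Phi D.Phi_injective D.Phi_mem D.exists_Phi_eq

theorem phiHomeo_apply (D : Diagram) (p : Sphere stdLattice) : D.phiHomeo p = D.phi p := rfl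

theorem phi_mem_corners (D : Diagram) {p : Sphere stdLattice} (hp : p ∈ corners stdLattice) :
    D.phi p ∈ corners (spanLattice D.lam₁ D.lam₂) := by
  obtain ⟨v, hv, rfl⟩ := hp
  exact ⟨D.Phi v, D.Phi_mem v hv, rfl⟩

/-- This already holds in the plane: with `M` the matrix with columns `λ₁, λ₂`, `A(Mx + b) = (AM)x +
Ab`, and `AM` has columns `Aλ₁, Aλ₂`. -/
theorem linSpan_phi (A : Matrix (Fin 2) (Fin 2) ℤ) (hA : 0 < A.det) (D : Diagram)
    (p : Sphere stdLattice) :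
    linSpan A D.lam₁ D.lam₂ (D.phi p) = (D.transform A hA).phi p := by
  refine Quotient.inductionOn p fun x => ?_
  refine congrArg (proj (spanLattice (A.mulVec D.lam₁) (A.mulVec D.lam₂))) ?_
  change linR A (linR (colMatrix D.lam₁ D.lam₂) x + toPlane D.b)
    = linR (colMatrix (A.mulVec D.lam₁) (A.mulVec D.lam₂)) x + toPlane (A.mulVec D.b)
  have h : colMatrix (A.mulVec D.lam₁) (A.mulVec D.lam₂) = A * colMatrix D.lam₁ D.lam₂ := by
    ext i j
    fin_cases i <;> fin_cases j <;> simp [colMatrix, Matrix.mul_apply]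
  have hmul : (A * colMatrix D.lam₁ D.lam₂).map (Int.cast : ℤ → ℝ)
      = A.map (Int.cast : ℤ → ℝ) * (colMatrix D.lam₁ D.lam₂).map (Int.cast : ℤ → ℝ) :=
    Matrix.map_mul (f := Int.castRingHom ℝ)
  rw [map_add, linR_toPlane, h]
  simp [linR, hmul]

theorem linStd_idBar (A : Matrix (Fin 2) (Fin 2) ℤ) (hA : 0 < A.det) (D : Diagram)
    (p : Sphere (spanLattice D.lam₁ D.lam₂)) :
    linStd A (D.idBar p) = (D.transform A hA).idBar (linSpan A D.lam₁ D.lam₂ p) :=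
  Quotient.inductionOn p fun _ => rfl

/-- The green arcs of `A · D` are the `A₁`-images of those of `D`, so the conjugated isotopy moves
corners along them. -/
theorem IsPush.transform {D : Diagram}
    {h : Sphere (spanLattice D.lam₁ D.lam₂) ≃ₜ Sphere (spanLattice D.lam₁ D.lam₂)}
    (hh : D.IsPush h) (A : Matrix (Fin 2) (Fin 2) ℤ) (hA : 0 < A.det) :
    (D.transform A hA).IsPush
      (((linSpanHomeo A hA D.lam₁ D.lam₂).symm.trans h).trans
        (linSpanHomeo A hA D.lam₁ D.lam₂)) := by
  obtain ⟨H, rfl, hH⟩ := hh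
  refine ⟨H.conj (linSpanHomeo A hA D.lam₁ D.lam₂), rfl, ?_⟩
  rintro _ ⟨β, hβ, rfl⟩ t
  change linSpanHomeo A hA D.lam₁ D.lam₂ (H.hom t ((linSpanHomeo A hA D.lam₁ D.lam₂).symm
    (linSpanHomeo A hA D.lam₁ D.lam₂ (β 0)))) = linSpanHomeo A hA D.lam₁ D.lam₂ (β t)
  rw [Homeomorph.symm_apply_apply, hH β hβ t]

/-- With primes for `A · D`: `A₂ ∘ idBar ∘ h ∘ φ = idBar' ∘ (A₁ ∘ h ∘ A₁⁻¹) ∘ φ'`. -/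
theorem Gives.transform {D : Diagram} {F : Sphere stdLattice → Sphere stdLattice}
    (hF : D.Gives F) (A : Matrix (Fin 2) (Fin 2) ℤ) (hA : 0 < A.det) :
    (D.transform A hA).Gives (linStd A ∘ F) := by
  obtain ⟨h, hh, rfl⟩ := hF
  refine ⟨_, hh.transform A hA, funext fun p => ?_⟩
  rw [← linSpan_phi A hA D p, ← linSpanHomeo_apply A hA]
  change linStd A (D.idBar (h (D.phi p))) = (D.transform A hA).idBar
    (linSpanHomeo A hA D.lam₁ D.lam₂ (h ((linSpanHomeo A hA D.lam₁ D.lam₂).symm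
      (linSpanHomeo A hA D.lam₁ D.lam₂ (D.phi p)))))
  rw [Homeomorph.symm_apply_apply, linStd_idBar A hA, linSpanHomeo_apply]

/-- The map `x ↦ -x` belongs to `Γ₂`, with translation part zero. -/
theorem linStd_neg_one : linStd (-1) = id := by
  funext p
  refine Quotient.inductionOn p fun x => ?_
  refine Quotient.sound ⟨0, stdLattice.zero_mem, Or.inr ?_⟩
  change x = (2 : ℝ) • 0 - linR (-1) x
  ext i
  fin_cases i <;> simp [linR]

theorem Gives.neg {D : Diagram} {F : Sphere stdLattice → Sphere stdLattice} (hF : D.Gives F) :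
    D.neg.Gives F := by
  have h := hF.transform (-1) (by simp [Matrix.det_fin_two])
  rwa [linStd_neg_one, Function.id_comp] at h

/-- Normalizing to `-D` rather than `D` avoids having to identify `-(-D)` with `D`. -/
theorem ClassGives.neg_gives {D : Diagram} {F : Sphere stdLattice → Sphere stdLattice}
    (hF : D.ClassGives F) : D.neg.Gives F := by
  obtain ⟨E, rfl | rfl, h⟩ := hF
  exacts [h.neg, h]

/-- Two maps given by the same diagram are isotopic: if `H` and `K` are ambient isotopies pushing
the corners along the green arcs, then `t ↦ H_t⁻¹ ∘ K_t` is stationary on the corners. -/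
theorem Gives.isotopicRel {D : Diagram} {F G : Sphere stdLattice → Sphere stdLattice}
    (hF : D.Gives F) (hG : D.Gives G) : IsotopicRel (corners stdLattice) F G := by
  obtain ⟨_, ⟨H, rfl, hH⟩, rfl⟩ := hF
  obtain ⟨_, ⟨K, rfl, hK⟩, rfl⟩ := hG
  refine ⟨(H.symmComp K).conj D.phiHomeo.symm, fun t p hp => ?_, funext fun p => ?_⟩
  -- The corner `φ(p)` starts some arc `β`: `K_t` takes it to `β t`, and `H_t⁻¹` brings it back.
  · obtain ⟨β, ⟨hβ, hβ0⟩, -⟩ := D.green_existsUnique _ (D.phi_mem_corners hp)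
    rw [AmbientIsotopy.conj_hom_apply, AmbientIsotopy.symmComp_hom_apply, Homeomorph.symm_symm,
      phiHomeo_apply, ← hβ0, hK β hβ, ← hH β hβ, Homeomorph.symm_apply_apply, hβ0,
      ← phiHomeo_apply, Homeomorph.symm_apply_apply]
  -- At time one, `φ ∘ φ⁻¹` and `H₁ ∘ H₁⁻¹` cancel, leaving `idBar ∘ K₁ ∘ φ`.
  · beta_reduce
    rw [← phiHomeo_apply D (((H.symmComp K).conj D.phiHomeo.symm).hom 1 p),
      AmbientIsotopy.conj_hom_apply, AmbientIsotopy.symmComp_hom_apply, Homeomorph.symm_symm,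
      Homeomorph.apply_symm_apply, Homeomorph.apply_symm_apply, phiHomeo_apply]

end Diagram

end NetMap

theorem theorem1p2 (A : Matrix (Fin 2) (Fin 2) ℤ) (hA : 0 < A.det) (D D' : NetMap.Diagram)
    (hD : NetMap.Diagram.transform A hA '' D.projClass = D'.projClass)
    (F : NetMap.Sphere NetMap.stdLattice → NetMap.Sphere NetMap.stdLattice)
    (hF : D.ClassGives F) :
    D'.ClassGives (NetMap.linStd A ∘ F) ∧
      ∀ F' : NetMap.Sphere NetMap.stdLattice → NetMap.Sphere NetMap.stdLattice,
        D'.ClassGives F' →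
          NetMap.IsotopicRel (NetMap.corners NetMap.stdLattice) (NetMap.linStd A ∘ F) F' := by
  have hAF : D'.ClassGives (NetMap.linStd A ∘ F) := by
    obtain ⟨E, hE, hEF⟩ := hF
    exact ⟨E.transform A hA, hD ▸ Set.mem_image_of_mem _ hE, hEF.transform A hA⟩
  -- Whichever representatives gave the two maps, both are also given by `-D'`.
  exact ⟨hAF, fun F' hF' => hAF.neg_gives.isotopicRel hF'.neg_gives⟩
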